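/- A hypergraph is a finite vertex set $V$ together with a finite multiset of edges, each a subset of $V$ with at least two elements. It is labeled if it has vertex set $[n]$ and, for each $i\ge 2$, its $\lambda_i$ edges of size $i$ are labeled by $[\lambda_i]$. A walk is a sequence $v_0,e_1,v_1,\dots,e_m,v_m$ with $v_{i-1},v_i\in e_i$; it is a path if all $v_i$ and all $e_i$ are distinct, and a cycle if $m\ge 2$, all $e_i$ are distinct, and all $v_i$ are distinct except that $v_0=v_m$. A hypergraph with at least one vertex is connected if any two vertices are joined by a path; a hypertree is a connected hypergraph with no cycles. For $\lambda=(\lambda_2,\lambda_3,\dots)$ with finitely many nonzero entries write $u^\lambda=\prod_i u_i^{\lambda_i}$ and $\lambda!=\prod_i\lambda_i!$, and let the magnitude of $u^\lambda$ be $\sum_i (i-1)\lambda_i$. Let $$C(t;u_2,u_3,\dots)=\sum_{n\ge1}\frac{t^n}{n!}C_n,\qquad C_n=\sum_\lambda c_{n,\lambda}\frac{u^\lambda}{\lambda!},$$ where $c_{n,\lambda}$ is the number of connected labeled hypergraphs on $[n]$ with $\lambda_i$ edges of size $i$ for each $i$. Let $T_n$ consist of all terms of magnitude $n-1$ in $C_n$,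 and let $T=\sum_{n\ge1}\frac{t^n}{n!}T_n$. Then: 1. Every term of $C_n$ has magnitude at least $n-1$ (so $T$ consists of the leading terms of $C$), and $T$ is the exponential generating function of labeled hypertrees: the coefficient of $\frac{t^n}{n!}\frac{u^\lambda}{\lambda!}$ in $T$ is the number of labeled hypertrees on $[n]$ with $\lambda_i$ edges of size $i$ for each $i$. 2. $\displaystyle \frac{\partial T}{\partial u_2}=\frac12\Bigl(t\frac{\partial T}{\partial t}\Bigr)^2$, and $\displaystyle \frac{\partial T}{\partial u_j}=\frac1j\Bigl(t\frac{\partial T}{\partial t}\Bigr)\frac{\partial T}{\partial u_{j-1}}$ for all $j\ge3$. 3. $\displaystyle \frac{\partial T}{\partial u_j}=\frac1{j!}\Bigl(t\frac{\partial T}{\partial t}\Bigr)^j$ for all $j\ge2$. 4. For all $j\ge 2$, $n$ and $\lambda$, the coefficient of $\frac{t^n}{n!}\frac{u^\lambda}{\lambda!}$ on the left side of 3 is the number of hypertrees on $[n]$ rooted at an unlabeled edge of size $j$ and having, besides the root edge, $\lambda_i$ labeled edges of size $i$ for each $i$. The same coefficient on the right side is the number of sets of $j$ vertex-rooted hypertrees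 whose vertex sets partition $[n]$ and whose edges, taken together, are $\lambda_i$ labeled edges of size $i$ for each $i$. Removing the root edge and rooting each resulting component at its vertex in that edge is a bijection from the former objects to the latter. -/

import Mathlib

open scoped Nat

namespace HypertreeEGF

/-- A hypergraph on the vertex set `V` whose edges are labeled by the elements of `E`. Every edge
is a set of at least two vertices; differently labeled edges may be equal as sets, so multiple
edges are allowed, loops are not, and a vertex may belong to no edge. -/
@[ext]
structure LabeledHypergraph (V E : Type) where
  edge : E → Finset V
  two_le_card : ∀ e, 2 ≤ (edge e).card

namespace LabeledHypergraph

variable {V E : Type}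

/-- `v 0, e 0, v 1, e 1, …, e (m - 1), v m` is a walk: consecutive vertices both lie in the edge
between them. -/
def IsWalk (H : LabeledHypergraph V E) {m : ℕ} (v : Fin (m + 1) → V) (e : Fin m → E) : Prop :=
  ∀ i : Fin m, v i.castSucc ∈ H.edge (e i) ∧ v i.succ ∈ H.edge (e i)

/-- A path is a walk whose vertices are distinct and whose edges are distinct. -/
def IsPath (H : LabeledHypergraph V E) {m : ℕ} (v : Fin (m + 1) → V) (e : Fin m → E) : Prop :=
  H.IsWalk v e ∧ Function.Injective v ∧ Function.Injective e

/-- A cycle is a walk with at least two edges whose edges are distinct and whose vertices are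
distinct except that the first and the last one coincide. -/
def IsCycle (H : LabeledHypergraph V E) {m : ℕ} (v : Fin (m + 1) → V) (e : Fin m → E) : Prop :=
  H.IsWalk v e ∧ 2 ≤ m ∧ Function.Injective e ∧
    Function.Injective (fun i : Fin m => v i.castSucc) ∧ v 0 = v (Fin.last m)

/-- Any two vertices are joined by a path. The hypergraph without vertices is not counted as
connected. -/
def IsConnected (H : LabeledHypergraph V E) : Prop :=
  Nonempty V ∧ ∀ x y : V, ∃ (m : ℕ) (v : Fin (m + 1) → V) (e : Fin m → E),
    H.IsPath v e ∧ v 0 = x ∧ v (Fin.last m) = y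

/-- A hypertree is a connected hypergraph with no cycles. -/
def IsHypertree (H : LabeledHypergraph V E) : Prop :=
  H.IsConnected ∧ ∀ (m : ℕ) (v : Fin (m + 1) → V) (e : Fin m → E), ¬ H.IsCycle v e

end LabeledHypergraph

/-- The possible edge sizes `2, 3, 4, …`. -/
abbrev EdgeSize : Type := {i : ℕ // 2 ≤ i}

/-- The edge labels when there are `l i` edges of size `i`: these are labeled by `Fin (l i)`
for each `i` separately. -/
abbrev EdgeLabel (l : EdgeSize →₀ ℕ) : Type := Σ i : EdgeSize, Fin (l i)

/-- The size of the edge with a given label. -/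
def EdgeLabel.size {l : EdgeSize →₀ ℕ} (e : EdgeLabel l) : ℕ := e.1.1

instance (l : EdgeSize →₀ ℕ) : Finite (EdgeLabel l) := by
  refine Finite.of_injective (β := Σ i : l.support, Fin (l i))
    (fun e => ⟨⟨e.1, by simp; have := e.2.pos; omega⟩, e.2⟩) ?_
  rintro ⟨a, b⟩ ⟨c, d⟩ h
  simp at h
  obtain ⟨rfl, h⟩ := h
  simp_all

instance {V E : Type} [Finite V] [Finite E] : Finite (LabeledHypergraph V E) :=
  Finite.of_injective _ fun _ _ h => LabeledHypergraph.ext h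

/-- Connected labeled hypergraphs with `n` labeled vertices and `l i` labeled `i`-edges. -/
def ConnectedHypergraphs (n : ℕ) (l : EdgeSize →₀ ℕ) :
    Set (LabeledHypergraph (Fin n) (EdgeLabel l)) :=
  {H | H.IsConnected ∧ ∀ e, (H.edge e).card = e.size}

/-- Labeled hypertrees with `n` labeled vertices and `l i` labeled `i`-edges. -/
def Hypertrees (n : ℕ) (l : EdgeSize →₀ ℕ) :
    Set (LabeledHypergraph (Fin n) (EdgeLabel l)) :=
  {H | H.IsHypertree ∧ ∀ e, (H.edge e).card = e.size}

/-- Formal power series over `ℚ` in `t` (the index `none`) and `u₂, u₃, …` (the indices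
`some i`). -/
abbrev Series : Type := MvPowerSeries (Option EdgeSize) ℚ

/-- The index of the variable `t`. -/
abbrev tVar : Option EdgeSize := none

/-- The index of the variable `u_j`. -/
abbrev uVar (j : ℕ) (hj : 2 ≤ j) : Option EdgeSize := some ⟨j, hj⟩

/-- The product `λ! = λ₂! λ₃! λ₄! ⋯`. -/
def multiFactorial (l : EdgeSize →₀ ℕ) : ℕ := l.prod fun _ k => k !

/-- The coefficient of `(t ^ n / n!) (u ^ λ / λ!)` in `F`. -/
noncomputable def egfCoeff (F : Series) (n : ℕ) (l : EdgeSize →₀ ℕ) : ℚ :=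
  n ! * multiFactorial l * MvPowerSeries.coeff (Finsupp.optionElim n l) F

/-- The magnitude `∑ (i - 1) λ_i` of `u ^ λ`. -/
def magnitude (l : EdgeSize →₀ ℕ) : ℕ := l.sum fun i k => (i.1 - 1) * k

/-- The exponential generating function of connected labeled hypergraphs,
`C = ∑ (number of connected hypergraphs) (t ^ n / n!) (u ^ λ / λ!)`. -/
noncomputable def C : Series := fun m =>
  ((ConnectedHypergraphs (m none) m.some).ncard : ℚ) / ((m none)! * multiFactorial m.some)

open scoped Classical in
/-- The series `T = ∑_{n ≥ 1} (t ^ n / n!) T_n`, where `T_n` consists of all the terms of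
magnitude `n - 1` in the coefficient `C_n` of `t ^ n / n!` in `C`. -/
noncomputable def T : Series := fun m =>
  if magnitude m.some + 1 = m none then MvPowerSeries.coeff m C else 0

/-- The operator `t ∂/∂t`. -/
noncomputable def tDeriv (F : Series) : Series :=
  MvPowerSeries.X tVar * MvPowerSeries.pderiv ℚ tVar F

/-- A hypertree that is rooted at an unlabeled `j`-edge (the edge `none`), on `n` labeled vertices
and with `l i` further labeled `i`-edges. -/
def EdgeRootedHypertree (n : ℕ) (l : EdgeSize →₀ ℕ) (j : ℕ) : Type :=
  {H : LabeledHypergraph (Fin n) (Option (EdgeLabel l)) //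
    H.IsHypertree ∧ (H.edge none).card = j ∧ ∀ e, (H.edge (some e)).card = e.size}

/-- A vertex-rooted hypertree whose vertices form a subset of `V` and whose edge labels form a
subset of `E`. -/
structure VertexRootedHypertree (V E : Type) where
  verts : Set V
  labels : Set E
  graph : LabeledHypergraph verts labels
  isHypertree : graph.IsHypertree
  root : verts

/-- The edge with label `e`, as a subset of the ambient vertex set. -/
def VertexRootedHypertree.edge {V E : Type} (P : VertexRootedHypertree V E) (e : P.labels) :
    Finset V :=
  (P.graph.edge e).map (Function.Embedding.subtype _)

/-- A set of `j` vertex-rooted hypertrees that together have `n` labeled vertices and `l i` labeled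
`i`-edges: every vertex and every edge label is used in exactly one of the hypertrees. -/
def VertexRootedHypertreeSet (n : ℕ) (l : EdgeSize →₀ ℕ) (j : ℕ) : Type :=
  {S : Finset (VertexRootedHypertree (Fin n) (EdgeLabel l)) //
    S.card = j ∧
    (∀ v, ∃! P, P ∈ S ∧ v ∈ P.verts) ∧
    (∀ e, ∃! P, P ∈ S ∧ e ∈ P.labels) ∧
    ∀ P ∈ S, ∀ e : P.labels, (P.edge e).card = e.1.size}

/-- `S` arises from `H` by removing the root edge: the roots in `S` are the vertices of the root
edge, and all other edges stay the same. -/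
def IsRemovalOfRootEdge {n : ℕ} {l : EdgeSize →₀ ℕ} {j : ℕ}
    (H : EdgeRootedHypertree n l j) (S : VertexRootedHypertreeSet n l j) : Prop :=
  (∀ v, v ∈ H.1.edge none ↔ ∃ P ∈ S.1, (P.root : Fin n) = v) ∧
    ∀ P ∈ S.1, ∀ e : P.labels, P.edge e = H.1.edge (some e.1)

end HypertreeEGF

open HypertreeEGF

/-!
Counting the edges of the bipartite graph of incidences between vertices and edges shows that a
connected hypergraph has at most one vertex more than its magnitude, with equality exactly for the
hypertrees; so the leading terms of `C` count hypertrees.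

The operator `∂/∂u_j` marks a `j`-edge whose label is then forgotten, and `t ∂/∂t` marks a vertex.
Without its root edge, a hypertree rooted at a `j`-edge falls apart into `j` components, each with
exactly one vertex in the root edge, and these form a set of `j` vertex-rooted hypertrees that
partitions the labels. Sets of `j` objects of this kind are counted by `(t ∂T/∂t)^j / j!`: the
coefficients of a product of exponential generating functions count the ways to distribute the
labels among the factors. Both sides of `∂T/∂u_j = (t ∂T/∂t)^j / j!` thus have the same
coefficients, and the recursions follow.
-/

namespace HypertreeEGF

/-! ### Coefficients of exponential generating functions -/

section ExponentialCoefficients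

variable {σ R : Type*} [CommSemiring R]

/-- The coefficient of `∏ xᵢ ^ mᵢ / mᵢ!` in `F`. -/
noncomputable def expCoeff (m : σ →₀ ℕ) (F : MvPowerSeries σ R) : R :=
  (m.prod fun _ k => k ! : ℕ) * MvPowerSeries.coeff m F

theorem prod_factorial_ne_zero (m : σ →₀ ℕ) : (m.prod fun _ k => k !) ≠ 0 :=
  Finset.prod_ne_zero_iff.2 fun _ _ => Nat.factorial_ne_zero _

theorem prod_factorial_add_single (m : σ →₀ ℕ) (s : σ) :
    ((m + Finsupp.single s 1).prod fun _ k => k !) = (m s + 1) * m.prod fun _ k => k ! := by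
  classical
  rw [← Finsupp.mul_prod_erase' (m + Finsupp.single s 1) s _ fun _ => Nat.factorial_zero,
    ← Finsupp.mul_prod_erase' m s _ fun _ => Nat.factorial_zero]
  simp [Finsupp.erase_add, Nat.factorial_succ, mul_assoc]

theorem expCoeff_zero (F : MvPowerSeries σ R) :
    expCoeff 0 F = MvPowerSeries.constantCoeff F := by
  simp [expCoeff, MvPowerSeries.coeff_zero_eq_constantCoeff]

theorem expCoeff_add_single (m : σ →₀ ℕ) (s : σ) (F : MvPowerSeries σ R) :
    expCoeff (m + Finsupp.single s 1) F = expCoeff m (MvPowerSeries.pderiv R s F) := by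
  rw [expCoeff, expCoeff, prod_factorial_add_single, MvPowerSeries.coeff_pderiv]
  push_cast
  ring

theorem expCoeff_X_mul_pderiv (m : σ →₀ ℕ) (s : σ) (F : MvPowerSeries σ R) :
    expCoeff m (MvPowerSeries.X s * MvPowerSeries.pderiv R s F) = m s * expCoeff m F := by
  suffices MvPowerSeries.coeff m (MvPowerSeries.X s * MvPowerSeries.pderiv R s F) =
      m s * MvPowerSeries.coeff m F by
    rw [expCoeff, this, expCoeff, mul_left_comm]
  classical
  by_cases h : Finsupp.single s 1 ≤ m
  · obtain ⟨k, rfl⟩ := le_iff_exists_add.1 h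
    rw [MvPowerSeries.X, MvPowerSeries.coeff_add_monomial_mul, MvPowerSeries.coeff_pderiv,
      add_comm k]
    simp [mul_comm, add_comm]
  · have hm : m s = 0 := by
      rwa [Finsupp.single_le_iff, Nat.one_le_iff_ne_zero, not_not] at h
    rw [MvPowerSeries.X, MvPowerSeries.coeff_monomial_mul, if_neg h, hm, Nat.cast_zero, zero_mul]

theorem expCoeff_sum {ι : Type*} (s : Finset ι) (m : σ →₀ ℕ) (F : ι → MvPowerSeries σ R) :
    expCoeff m (∑ i ∈ s, F i) = ∑ i ∈ s, expCoeff m (F i) := by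
  simp [expCoeff, Finset.mul_sum]

theorem expCoeff_smul (m : σ →₀ ℕ) (a : R) (F : MvPowerSeries σ R) :
    expCoeff m (a • F) = a * expCoeff m F := by
  simp [expCoeff, mul_left_comm]

theorem derivation_prod {A M ι : Type*} [CommSemiring A] [Algebra R A] [AddCommMonoid M]
    [Module A M] [Module R M] [DecidableEq ι] (D : Derivation R A M) (s : Finset ι) (f : ι → A) :
    D (∏ i ∈ s, f i) = ∑ i ∈ s, (∏ k ∈ s.erase i, f k) • D (f i) := by
  induction s using Finset.induction_on with
  | empty => simp
  | insert a s ha ih =>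
    rw [Finset.prod_insert ha, Derivation.leibniz, ih, Finset.sum_insert ha, add_comm,
      Finset.erase_insert ha, Finset.smul_sum]
    congr 1
    refine Finset.sum_congr rfl fun i hi => ?_
    have hai : a ≠ i := (ne_of_mem_of_not_mem hi ha).symm
    rw [Finset.erase_insert_of_ne hai, Finset.prod_insert (by simp [ha]), mul_smul]

theorem expCoeff_add_single_prod {ι : Type*} [Fintype ι] [DecidableEq ι] (m : σ →₀ ℕ) (s : σ)
    (F : ι → MvPowerSeries σ R) :
    expCoeff (m + Finsupp.single s 1) (∏ i, F i) =
      ∑ k, expCoeff m (∏ i, Function.update F k (MvPowerSeries.pderiv R s (F k)) i) := by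
  rw [expCoeff_add_single, derivation_prod, expCoeff_sum]
  refine Finset.sum_congr rfl fun k _ => ?_
  rw [Finset.prod_update_of_mem (Finset.mem_univ k), smul_eq_mul, mul_comm,
    Finset.sdiff_singleton_eq_erase]

/-- The exponent of the monomial `∏ x_{c a}`, taken over all elements `a` of `A`: the number of
elements of each color in a set whose elements are colored by variables. It is `0` if `A` is
infinite. -/
noncomputable def colorCount {α : Type*} (c : α → σ) (A : Set α) : σ →₀ ℕ :=
  ∑ᶠ a ∈ A, Finsupp.single (c a) 1

variable {α β : Type*}

theorem colorCount_apply [Finite α] (c : α → σ) (A : Set α) (s : σ) :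
    colorCount c A s = (A ∩ c ⁻¹' {s}).ncard := by
  classical
  change Finsupp.applyAddHom s (colorCount c A) = _
  rw [colorCount, AddMonoidHom.map_finsum_mem _ _ A.toFinite, ← finsum_one]
  simp only [Finsupp.applyAddHom_apply, Finsupp.single_apply, finsum_eq_if, Set.mem_inter_iff,
    Set.mem_preimage, Set.mem_singleton_iff, ite_and]

theorem colorCount_image {f : β → α} (hf : f.Injective) (c : α → σ) (B : Set β) :
    colorCount c (f '' B) = colorCount (c ∘ f) B :=
  finsum_mem_image hf.injOn

theorem colorCount_comp_equiv (e : β ≃ α) (c : α → σ) (A : Set α) :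
    colorCount (c ∘ e) (e ⁻¹' A) = colorCount c A := by
  rw [← colorCount_image e.injective, Set.image_preimage_eq _ e.surjective]

theorem colorCount_comp_val (c : α → σ) (A : Set α) :
    colorCount (fun a : A => c a) Set.univ = colorCount c A := by
  conv_rhs => rw [← Subtype.coe_image_univ A, colorCount_image Subtype.val_injective]
  rfl

theorem colorCount_of_none_mem [Finite α] (c : Option α → σ) {A : Set (Option α)}
    (h : none ∈ A) :
    colorCount c A = colorCount (c ∘ some) (some ⁻¹' A) + Finsupp.single (c none) 1 := by
  have hA : insert none (some '' (some ⁻¹' A)) = A := by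
    ext (_ | a) <;> simp [h]
  rw [← colorCount_image (Option.some_injective _), add_comm]
  conv_lhs => rw [← hA]
  exact finsum_mem_insert _ (by simp) (Set.toFinite _)

theorem colorCount_of_none_notMem (c : Option α → σ) {A : Set (Option α)} (h : none ∉ A) :
    colorCount c A = colorCount (c ∘ some) (some ⁻¹' A) := by
  have hA : some '' (some ⁻¹' A) = A := by
    ext (_ | a) <;> simp [h]
  rw [← colorCount_image (Option.some_injective _), hA]

/-- The labels are distributed among the factors: each new label of color `s` turns the product
rule for `∂/∂x_s` into the choice of a factor. -/
theorem expCoeff_prod {ι : Type*} [Fintype ι] [Fintype α] [DecidableEq α]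
    (c : α → σ) (F : ι → MvPowerSeries σ R) :
    expCoeff (colorCount c Set.univ) (∏ i, F i) =
      ∑ h : α → ι, ∏ i, expCoeff (colorCount c (h ⁻¹' {i})) (F i) := by
  classical
  revert c F
  refine Fintype.induction_empty_option (P := fun α _ => ∀ [DecidableEq α] (c : α → σ)
    (F : ι → MvPowerSeries σ R), expCoeff (colorCount c Set.univ) (∏ i, F i) =
      ∑ h : α → ι, ∏ i, expCoeff (colorCount c (h ⁻¹' {i})) (F i)) ?_ ?_ ?_ α
  · intro α β _ e ih _ c F
    let _ := Fintype.ofEquiv β e.symm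
    rw [← colorCount_comp_equiv e, Set.preimage_univ, ih]
    refine Fintype.sum_equiv (Equiv.arrowCongr e (Equiv.refl ι)) _ _ fun h =>
      Finset.prod_congr rfl fun i _ => ?_
    have he : Equiv.arrowCongr e (Equiv.refl ι) h ∘ e = h := by
      ext
      simp
    rw [← colorCount_comp_equiv e c, ← Set.preimage_comp, he]
  · intro _ c F
    have hc (A : Set PEmpty) : colorCount c A = 0 := by
      rw [A.eq_empty_of_isEmpty]
      exact finsum_mem_empty
    simp [hc, expCoeff_zero]
  · intro α _ ih _ c F
    rw [colorCount_of_none_mem c (Set.mem_univ _), Set.preimage_univ, expCoeff_add_single_prod]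
    simp_rw [ih]
    rw [← Fintype.sum_prod_type']
    refine Fintype.sum_equiv (Equiv.piOptionEquivProd (β := fun _ => ι)).symm _ _ ?_
    rintro ⟨k, h⟩
    refine Finset.prod_congr rfl fun i _ => ?_
    have hmem : none ∈ (Equiv.piOptionEquivProd (β := fun _ => ι)).symm (k, h) ⁻¹' {i} ↔ k = i :=
      Iff.rfl
    by_cases hk : k = i
    · rw [colorCount_of_none_mem c (hmem.2 hk), expCoeff_add_single, ← hk, Function.update_self]
      rfl
    · rw [colorCount_of_none_notMem c (hmem.not.2 hk), Function.update_of_ne (Ne.symm hk)]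
      rfl

end ExponentialCoefficients

/-! ### Sets of structures with disjoint supports -/

section Families

variable {σ α ι Y : Type*}

theorem card_pi_existsUnique_mem [Fintype α] [DecidableEq α] [Fintype ι] [Finite Y]
    (supp : Y → Set α) (𝒴 : ι → Set Y) :
    Nat.card {q : ι → Y // (∀ i, q i ∈ 𝒴 i) ∧ ∀ a, ∃! i, a ∈ supp (q i)} =
      ∑ h : α → ι, ∏ i, Nat.card {y // y ∈ 𝒴 i ∧ supp y = h ⁻¹' {i}} := by
  simp_rw [← Nat.card_pi, ← Nat.card_sigma]
  have hmem (h : α → ι) (q : ∀ i, {y // y ∈ 𝒴 i ∧ supp y = h ⁻¹' {i}}) (a : α) (i : ι) :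
      a ∈ supp (q i) ↔ h a = i := by
    rw [(q i).2.2]
    rfl
  symm
  refine Nat.card_eq_of_bijective (fun p : Σ h : α → ι, ∀ i, {y // y ∈ 𝒴 i ∧ supp y = h ⁻¹' {i}} =>
    ⟨fun i => (p.2 i).1, fun i => (p.2 i).2.1, forall_existsUnique_iff.2
      ⟨p.1, hmem p.1 p.2 _ _⟩⟩) ⟨?_, ?_⟩
  · rintro ⟨h, q⟩ ⟨h', q'⟩ hq
    have hval (i : ι) : (q i : Y) = q' i := congrFun (congrArg Subtype.val hq) i
    obtain rfl : h = h' := by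
      funext a
      exact ((hmem h' q' a (h a)).1 (hval (h a) ▸ (hmem h q a (h a)).2 rfl)).symm
    congr
    funext i
    exact Subtype.ext (hval i)
  · rintro ⟨q, hq, hcover⟩
    obtain ⟨h, hh⟩ := forall_existsUnique_iff.1 hcover
    exact ⟨⟨h, fun i => ⟨q i, hq i, Set.ext fun _ => hh⟩⟩, rfl⟩

theorem map_univ_equiv_trans_subtype [Fintype ι] (S : Finset Y) (e : ι ≃ S) :
    Finset.univ.map (e.toEmbedding.trans (Function.Embedding.subtype _)) = S := by
  rw [← Finset.map_map, Finset.map_univ_equiv, Finset.univ_eq_attach, Finset.attach_map_val]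

theorem card_embedding_map_univ [Fintype ι] [Finite Y] (p : Finset Y → Prop) :
    Nat.card {q : ι ↪ Y // p (Finset.univ.map q)} =
      (Fintype.card ι)! * Nat.card {S : Finset Y // S.card = Fintype.card ι ∧ p S} := by
  classical
  have := Fintype.ofFinite {S : Finset Y // S.card = Fintype.card ι ∧ p S}
  have hsigma : Nat.card (Σ S : {S : Finset Y // S.card = Fintype.card ι ∧ p S}, ι ≃ S.1) =
      (Fintype.card ι)! * Nat.card {S : Finset Y // S.card = Fintype.card ι ∧ p S} := by
    have hcard (S : {S : Finset Y // S.card = Fintype.card ι ∧ p S}) :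
        Nat.card (ι ≃ S.1) = (Fintype.card ι)! := by
      have e : ι ≃ S.1 := Fintype.equivOfCardEq (by simp [S.2.1])
      rw [Nat.card_eq_fintype_card, Fintype.card_equiv e]
    rw [Nat.card_sigma, Finset.sum_congr rfl fun S _ => hcard S]
    simp [mul_comm]
  rw [← hsigma]
  symm
  refine Nat.card_eq_of_bijective
    (fun x : Σ S : {S : Finset Y // S.card = Fintype.card ι ∧ p S}, ι ≃ S.1 =>
      ⟨x.2.toEmbedding.trans (Function.Embedding.subtype _), by
        rw [map_univ_equiv_trans_subtype]
        exact x.1.2.2⟩) ⟨?_, ?_⟩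
  · rintro ⟨⟨S, hS⟩, e⟩ ⟨⟨S', hS'⟩, e'⟩ h
    have hq : e.toEmbedding.trans (Function.Embedding.subtype (· ∈ S)) =
        e'.toEmbedding.trans (Function.Embedding.subtype (· ∈ S')) := congrArg Subtype.val h
    obtain rfl : S = S' := by
      rw [← map_univ_equiv_trans_subtype S e, hq, map_univ_equiv_trans_subtype]
    congr
    ext i
    exact DFunLike.congr_fun hq i
  · rintro ⟨q, hq⟩
    exact ⟨⟨⟨Finset.univ.map q, by simp, hq⟩, (Equiv.ofInjective q q.injective).trans
      (Equiv.subtypeEquivRight (by simp))⟩, rfl⟩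

theorem existsUnique_mem_map_univ_iff [Fintype ι] (q : ι ↪ Y) (p : Y → Prop) :
    (∃! y, y ∈ Finset.univ.map q ∧ p y) ↔ ∃! i, p (q i) := by
  constructor
  · rintro ⟨y, ⟨hy, hp⟩, huniq⟩
    obtain ⟨i, -, rfl⟩ := Finset.mem_map.1 hy
    exact ⟨i, hp, fun k hk => q.injective (huniq _ ⟨by simp, hk⟩)⟩
  · rintro ⟨i, hp, huniq⟩
    refine ⟨q i, ⟨by simp, hp⟩, ?_⟩
    rintro y ⟨hy, hpy⟩
    obtain ⟨k, -, rfl⟩ := Finset.mem_map.1 hy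
    rw [huniq k hpy]

theorem injective_of_existsUnique_mem {supp : Y → Set α} {q : ι → Y}
    (hne : ∀ i, (supp (q i)).Nonempty) (hq : ∀ a, ∃! i, a ∈ supp (q i)) : q.Injective := by
  intro i k hik
  obtain ⟨a, ha⟩ := hne i
  exact (hq a).unique ha (hik ▸ ha)

theorem card_pi_eq_factorial_mul_card_finset [Fintype ι] [Finite Y] (supp : Y → Set α)
    (𝒴 : Set Y) (hne : ∀ y ∈ 𝒴, (supp y).Nonempty) :
    Nat.card {q : ι → Y // (∀ i, q i ∈ 𝒴) ∧ ∀ a, ∃! i, a ∈ supp (q i)} =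
      (Fintype.card ι)! * Nat.card {S : Finset Y // S.card = Fintype.card ι ∧
        (∀ y ∈ S, y ∈ 𝒴) ∧ ∀ a, ∃! y, y ∈ S ∧ a ∈ supp y} := by
  rw [← card_embedding_map_univ]
  simp_rw [existsUnique_mem_map_univ_iff]
  refine Nat.card_congr
    { toFun := fun q => ⟨⟨q.1, injective_of_existsUnique_mem (fun i => hne _ (q.2.1 i)) q.2.2⟩,
        by simpa using q.2⟩
      invFun := fun q => ⟨q.1, by simpa using q.2⟩
      left_inv := fun _ => rfl
      right_inv := fun _ => rfl }

theorem expCoeff_smul_pow_eq_card_finset [Finite α] [Finite Y] (supp : Y → Set α)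
    (𝒴 : Set Y) (hne : ∀ y ∈ 𝒴, (supp y).Nonempty) {R : Type*} [Field R] [CharZero R]
    (c : α → σ) (F : MvPowerSeries σ R)
    (hF : ∀ s, expCoeff (colorCount c s) F = Nat.card {y // y ∈ 𝒴 ∧ supp y = s}) (j : ℕ) :
    expCoeff (colorCount c Set.univ) ((1 / j ! : R) • F ^ j) =
      Nat.card {S : Finset Y // S.card = j ∧ (∀ y ∈ S, y ∈ 𝒴) ∧
        ∀ a, ∃! y, y ∈ S ∧ a ∈ supp y} := by
  classical
  have := Fintype.ofFinite α
  have hpow : expCoeff (colorCount c Set.univ) (F ^ j) =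
      Nat.card {q : Fin j → Y // (∀ i, q i ∈ 𝒴) ∧ ∀ a, ∃! i, a ∈ supp (q i)} := by
    rw [card_pi_existsUnique_mem supp fun _ => 𝒴, ← Fin.prod_const, expCoeff_prod]
    simp_rw [hF]
    push_cast
    rfl
  have hj : (j ! : R) ≠ 0 := Nat.cast_ne_zero.2 j.factorial_ne_zero
  rw [expCoeff_smul, hpow, card_pi_eq_factorial_mul_card_finset supp 𝒴 hne, Fintype.card_fin]
  push_cast
  field_simp

end Families

/-! ### Hypertrees and their incidence graphs -/

namespace LabeledHypergraph

variable {V E : Type}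

/-- Two vertices are adjacent if some edge contains both of them. Every vertex of an edge is
adjacent to itself. -/
def Adjacent (H : LabeledHypergraph V E) (x y : V) : Prop :=
  ∃ e, x ∈ H.edge e ∧ y ∈ H.edge e

/-- The equivalence relation generated by adjacency, whose classes are the connected components.
Adjacency is symmetric, so its reflexive transitive closure suffices. -/
def Linked (H : LabeledHypergraph V E) : V → V → Prop :=
  Relation.ReflTransGen H.Adjacent

/-- The bipartite graph of incidences between vertices and edges. -/
def incidenceGraph (H : LabeledHypergraph V E) : SimpleGraph (V ⊕ E) where
  Adj
    | .inl v, .inr e => v ∈ H.edge e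
    | .inr e, .inl v => v ∈ H.edge e
    | _, _ => False
  symm := ⟨by rintro (v | e) (w | f) h <;> exact h⟩
  loopless := ⟨by rintro (v | e) h <;> exact h⟩

theorem edge_nonempty (H : LabeledHypergraph V E) (e : E) : (H.edge e).Nonempty :=
  Finset.card_pos.1 (lt_of_lt_of_le two_pos (H.two_le_card e))

variable {H : LabeledHypergraph V E}

theorem Linked.refl (x : V) : H.Linked x x := Relation.ReflTransGen.refl

theorem Linked.symm {x y : V} (h : H.Linked x y) : H.Linked y x := by
  have : Std.Symm H.Adjacent := ⟨fun _ _ ⟨e, h1, h2⟩ => ⟨e, h2, h1⟩⟩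
  exact Std.Symm.symm (r := Relation.ReflTransGen H.Adjacent) _ _ h

theorem Linked.trans {x y z : V} (h : H.Linked x y) (h' : H.Linked y z) : H.Linked x z :=
  Relation.ReflTransGen.trans h h'

theorem linked_of_mem {e : E} {x y : V} (hx : x ∈ H.edge e) (hy : y ∈ H.edge e) :
    H.Linked x y := Relation.ReflTransGen.single ⟨e, hx, hy⟩

theorem IsWalk.linked {m : ℕ} {v : Fin (m + 1) → V} {e : Fin m → E} (h : H.IsWalk v e)
    (i : Fin (m + 1)) : H.Linked (v 0) (v i) := by
  induction i using Fin.induction with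
  | zero => exact Linked.refl _
  | succ i ih => exact ih.trans (linked_of_mem (h i).1 (h i).2)

theorem incidenceGraph_adj_inl_inr {v : V} {e : E} :
    H.incidenceGraph.Adj (.inl v) (.inr e) ↔ v ∈ H.edge e :=
  Iff.rfl

theorem Linked.reachable {x y : V} (h : H.Linked x y) :
    H.incidenceGraph.Reachable (.inl x) (.inl y) := by
  induction h with
  | refl => exact SimpleGraph.Reachable.refl _
  | tail _ hadj ih =>
    obtain ⟨e, hx, hy⟩ := hadj
    exact ih.trans ((incidenceGraph_adj_inl_inr.2 hx).reachable.trans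
      (incidenceGraph_adj_inl_inr.2 hy).symm.reachable)

/-- The coloring of the incidence graph that tells vertices from edges. -/
def incidenceColoring (H : LabeledHypergraph V E) : H.incidenceGraph.Coloring Bool :=
  SimpleGraph.Coloring.mk Sum.isLeft fun {a b} h => by
    rcases a with v | e <;> rcases b with w | f <;> first | exact h.elim | simp

theorem isLeft_getVert_iff_even {x : V} {w : V ⊕ E} (p : H.incidenceGraph.Walk (.inl x) w)
    {i : ℕ} (hi : i ≤ p.length) : (p.getVert i).isLeft ↔ Even i := by
  have hparity := H.incidenceColoring.even_length_iff_congr (p.take i)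
  rw [SimpleGraph.Walk.take_length, min_eq_left hi] at hparity
  exact ⟨fun h => hparity.2 (iff_of_true rfl h), fun h => (hparity.1 h).1 rfl⟩

theorem exists_isWalk_of_walk {x y : V} (p : H.incidenceGraph.Walk (.inl x) (.inl y)) :
    ∃ (m : ℕ) (v : Fin (m + 1) → V) (e : Fin m → E), p.length = 2 * m ∧ H.IsWalk v e ∧
      (∀ i : Fin (m + 1), p.getVert (2 * i) = .inl (v i)) ∧
      ∀ i : Fin m, p.getVert (2 * i + 1) = .inr (e i) := by
  obtain ⟨m, hm⟩ : ∃ m, p.length = 2 * m := by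
    rw [← even_iff_exists_two_mul, ← isLeft_getVert_iff_even p le_rfl, p.getVert_length]
    rfl
  have hleft (i : Fin (m + 1)) : ∃ v, p.getVert (2 * i) = .inl v := by
    rw [← Sum.isLeft_iff, isLeft_getVert_iff_even p (by omega)]
    exact even_two_mul _
  have hright (i : Fin m) : ∃ e, p.getVert (2 * i + 1) = .inr e := by
    rw [← Sum.isRight_iff, ← Sum.not_isLeft, isLeft_getVert_iff_even p (by omega)]
    simp
  choose v hv using hleft
  choose e he using hright
  refine ⟨m, v, e, hm, fun i => ⟨?_, ?_⟩, hv, he⟩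
  · have hadj := p.adj_getVert_succ (i := 2 * i) (by omega)
    rwa [show p.getVert (2 * i) = .inl (v i.castSucc) from hv i.castSucc, he] at hadj
  · have hadj := p.adj_getVert_succ (i := 2 * i + 1) (by omega)
    rwa [show p.getVert (2 * i + 1 + 1) = .inl (v i.succ) from hv i.succ, he] at hadj

theorem Linked.exists_isPath {x y : V} (h : H.Linked x y) :
    ∃ (m : ℕ) (v : Fin (m + 1) → V) (e : Fin m → E),
      H.IsPath v e ∧ v 0 = x ∧ v (Fin.last m) = y := by
  obtain ⟨p, hp⟩ := h.reachable.exists_isPath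
  obtain ⟨m, v, e, hm, hwalk, hv, he⟩ := exists_isWalk_of_walk p
  have hinj := hp.getVert_injOn
  refine ⟨m, v, e, ⟨hwalk, fun i k hik => ?_, fun i k hik => ?_⟩, ?_, ?_⟩
  · have := @hinj (2 * i) (by simp; omega) (2 * k) (by simp; omega) (by rw [hv, hv, hik])
    omega
  · have := @hinj (2 * i + 1) (by simp; omega) (2 * k + 1) (by simp; omega)
      (by rw [he, he, hik])
    omega
  · simpa using (hv 0).symm
  · have hlast := hv (Fin.last m)
    rw [Fin.val_last, ← hm, p.getVert_length] at hlast
    exact (Sum.inl_injective hlast).symm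

theorem isConnected_iff_linked : H.IsConnected ↔ Nonempty V ∧ ∀ x y, H.Linked x y := by
  refine and_congr_right fun _ => forall₂_congr fun x y => ⟨?_, Linked.exists_isPath⟩
  rintro ⟨m, v, e, hp, rfl, rfl⟩
  exact hp.1.linked _

theorem IsConnected.incidenceGraph_connected (h : H.IsConnected) :
    H.incidenceGraph.Connected := by
  obtain ⟨⟨x⟩, h⟩ := isConnected_iff_linked.1 h
  refine (SimpleGraph.connected_iff_exists_forall_reachable _).2 ⟨.inl x, ?_⟩
  rintro (y | e)
  · exact (h x y).reachable
  · obtain ⟨y, hy⟩ := H.edge_nonempty e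
    exact (h x y).reachable.trans (incidenceGraph_adj_inl_inr.2 hy).reachable

theorem reachable_of_forall_adj {G : SimpleGraph (V ⊕ E)} {m : ℕ} {v : Fin (m + 1) → V}
    {e : Fin m → E} (h : ∀ i, G.Adj (.inl (v i.castSucc)) (.inr (e i)) ∧
      G.Adj (.inl (v i.succ)) (.inr (e i))) (i : Fin (m + 1)) :
    G.Reachable (.inl (v 0)) (.inl (v i)) := by
  induction i using Fin.induction with
  | zero => exact SimpleGraph.Reachable.refl _
  | succ i ih => exact ih.trans ((h i).1.reachable.trans (h i).2.symm.reachable)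

/-- After the first incidence of the cycle is deleted, the rest of the cycle still joins its
ends, so this incidence is not a bridge. -/
theorem IsCycle.not_isAcyclic_incidenceGraph {m : ℕ} {v : Fin (m + 1) → V} {e : Fin m → E}
    (h : H.IsCycle v e) : ¬ H.incidenceGraph.IsAcyclic := by
  obtain ⟨hw, hm, he, hv, hclosed⟩ := h
  obtain ⟨k, rfl⟩ : ∃ k, m = k + 2 := ⟨m - 2, by omega⟩
  intro hacyclic
  have hbridge := SimpleGraph.isAcyclic_iff_forall_adj_isBridge.1 hacyclic
    (incidenceGraph_adj_inl_inr.2 (hw 0).1)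
  rw [SimpleGraph.isBridge_iff] at hbridge
  set G := H.incidenceGraph.deleteEdges {s(.inl (v (Fin.castSucc 0)), .inr (e 0))} with hG
  have hadj {x : V} {f : E} (hx : x ∈ H.edge f) (hne : x = v (Fin.castSucc 0) → f ≠ e 0) :
      G.Adj (.inl x) (.inr f) := by
    rw [hG, SimpleGraph.deleteEdges_adj]
    exact ⟨hx, by simpa using hne⟩
  have hfirst : G.Adj (.inl (v (Fin.succ 0))) (.inr (e 0)) :=
    hadj (hw 0).2 fun h => by simpa using @hv 1 0 h
  have hrest := reachable_of_forall_adj (G := G) (v := v ∘ Fin.succ) (e := e ∘ Fin.succ)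
    (fun i => ⟨hadj (hw i.succ).1 fun _ => he.ne (Fin.succ_ne_zero i),
      hadj (hw i.succ).2 fun _ => he.ne (Fin.succ_ne_zero i)⟩) (Fin.last _)
  refine hbridge (SimpleGraph.Reachable.symm (hfirst.symm.reachable.trans ?_))
  rw [Fin.castSucc_zero, hclosed]
  exact hrest

theorem exists_isCycle_of_walk_isCycle {x : V} {c : H.incidenceGraph.Walk (.inl x) (.inl x)}
    (hc : c.IsCycle) : ∃ (m : ℕ) (v : Fin (m + 1) → V) (e : Fin m → E), H.IsCycle v e := by
  obtain ⟨m, v, e, hm, hwalk, hv, he⟩ := exists_isWalk_of_walk c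
  have hlength := hc.three_le_length
  have hinj := hc.getVert_injOn'
  refine ⟨m, v, e, hwalk, by omega, fun i k hik => ?_, fun i k hik => ?_, ?_⟩
  · have := @hinj (2 * i + 1) (by simp; omega) (2 * k + 1) (by simp; omega)
      (by rw [he, he, hik])
    omega
  · have := @hinj (2 * i) (by simp; omega) (2 * k) (by simp; omega)
      ((hv i.castSucc).trans ((congrArg _ hik).trans (hv k.castSucc).symm))
    omega
  · have hlast := hv (Fin.last m)
    rw [Fin.val_last, ← hm, c.getVert_length] at hlast
    exact Sum.inl_injective ((c.getVert_zero.symm.trans (hv 0)).symm.trans hlast)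

theorem incidenceGraph_isAcyclic_iff :
    H.incidenceGraph.IsAcyclic ↔
      ∀ (m : ℕ) (v : Fin (m + 1) → V) (e : Fin m → E), ¬ H.IsCycle v e := by
  classical
  refine ⟨fun h m v e hc => hc.not_isAcyclic_incidenceGraph h, fun h => ?_⟩
  have hvertex (x : V) (c : H.incidenceGraph.Walk (.inl x) (.inl x)) : ¬ c.IsCycle := fun hc =>
    have ⟨m, v, e, hcycle⟩ := exists_isCycle_of_walk_isCycle hc
    h m v e hcycle
  rintro (x | f) c hc
  · exact hvertex x c hc
  · have hadj := c.adj_snd hc.not_nil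
    rcases hsnd : c.snd with y | g
    · exact hvertex y _ (hc.rotate (hsnd ▸ c.getVert_mem_support 1))
    · rw [hsnd] at hadj
      exact hadj

theorem card_incidenceGraph_edgeSet [Finite V] [Fintype E] :
    Nat.card H.incidenceGraph.edgeSet = ∑ e, (H.edge e).card := by
  let incidence (q : Σ e, H.edge e) : H.incidenceGraph.edgeSet :=
    ⟨s(.inl q.2.1, .inr q.1), q.2.2⟩
  have hbij : incidence.Bijective := by
    constructor
    · rintro ⟨e, v, hv⟩ ⟨f, w, hw⟩ h
      have hpair : (s(.inl v, .inr e) : Sym2 (V ⊕ E)) = s(.inl w, .inr f) :=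
        congrArg Subtype.val h
      obtain ⟨rfl, rfl⟩ : v = w ∧ e = f := by simpa using hpair
      rfl
    · rintro ⟨q, hq⟩
      induction q with
      | h a b =>
        rcases a with v | e <;> rcases b with w | f
        · exact hq.elim
        · exact ⟨⟨f, v, hq⟩, rfl⟩
        · exact ⟨⟨e, w, hq⟩, Subtype.ext Sym2.eq_swap⟩
        · exact hq.elim
  rw [← Nat.card_eq_of_bijective _ hbij, Nat.card_sigma]
  simp

theorem sum_card_edge [Fintype E] :
    ∑ e, (H.edge e).card = ∑ e, ((H.edge e).card - 1) + Nat.card E := by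
  rw [Nat.card_eq_fintype_card, ← Finset.card_univ, Finset.card_eq_sum_ones,
    ← Finset.sum_add_distrib]
  exact Finset.sum_congr rfl fun e _ => by have := H.two_le_card e; omega

theorem IsConnected.card_le [Finite V] [Fintype E] (h : H.IsConnected) :
    Nat.card V ≤ ∑ e, ((H.edge e).card - 1) + 1 := by
  have hcard := h.incidenceGraph_connected.card_vert_le_card_edgeSet_add_one
  rw [card_incidenceGraph_edgeSet, sum_card_edge, Nat.card_sum] at hcard
  omega

theorem isHypertree_iff_card [Finite V] [Fintype E] :
    H.IsHypertree ↔ H.IsConnected ∧ Nat.card V = ∑ e, ((H.edge e).card - 1) + 1 := by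
  refine and_congr_right fun hc => ?_
  have htree := SimpleGraph.isTree_iff_connected_and_card (G := H.incidenceGraph)
  rw [SimpleGraph.isTree_iff, and_congr_right_iff] at htree
  rw [← incidenceGraph_isAcyclic_iff, htree hc.incidenceGraph_connected,
    card_incidenceGraph_edgeSet, sum_card_edge, Nat.card_sum]
  omega

end LabeledHypergraph

/-! ### Removal of the root edge -/

namespace LabeledHypergraph

variable {V E V' E' : Type}

section Map

variable {H : LabeledHypergraph V E} {G : LabeledHypergraph V' E'}

theorem IsCycle.map {m : ℕ} {v : Fin (m + 1) → V'} {e : Fin m → E'} (h : G.IsCycle v e)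
    {f : V' → V} {g : E' → E} (hf : f.Injective) (hg : g.Injective)
    (hfg : ∀ v e, v ∈ G.edge e → f v ∈ H.edge (g e)) : H.IsCycle (f ∘ v) (g ∘ e) :=
  have ⟨hw, hm, he, hv, hclosed⟩ := h
  ⟨fun i => ⟨hfg _ _ (hw i).1, hfg _ _ (hw i).2⟩, hm, hg.comp he, hf.comp hv,
    congrArg f hclosed⟩

theorem Linked.map {x y : V'} (h : G.Linked x y) (f : V' → V) (g : E' → E)
    (hfg : ∀ v e, v ∈ G.edge e → f v ∈ H.edge (g e)) : H.Linked (f x) (f y) :=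
  Relation.ReflTransGen.lift f (fun _ _ ⟨e, hx, hy⟩ => ⟨g e, hfg _ _ hx, hfg _ _ hy⟩) _ _ h

end Map

section Component

variable {H : LabeledHypergraph V E} {r : V}

open scoped Classical in
/-- The connected component of the vertex `r`, with the edges that meet it. -/
noncomputable def component (H : LabeledHypergraph V E) (r : V) :
    LabeledHypergraph {v | H.Linked r v} {e | ∃ v ∈ H.edge e, H.Linked r v} where
  edge e := (H.edge e).subtype (· ∈ {v | H.Linked r v})
  two_le_card e := by
    obtain ⟨e, v, hv, hr⟩ := e
    rw [Finset.card_subtype, Finset.filter_true_of_mem]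
    · exact H.two_le_card e
    · exact fun w hw => hr.trans (linked_of_mem hv hw)

theorem mem_component_edge {e : {e | ∃ v ∈ H.edge e, H.Linked r v}} {v : {v | H.Linked r v}} :
    v ∈ (H.component r).edge e ↔ v.1 ∈ H.edge e := by
  classical
  exact Finset.mem_subtype

theorem map_component_edge (e : {e | ∃ v ∈ H.edge e, H.Linked r v}) :
    ((H.component r).edge e).map (Function.Embedding.subtype _) = H.edge e := by
  ext v
  simp only [Finset.mem_map, mem_component_edge, Function.Embedding.subtype_apply, Subtype.exists,
    exists_and_right, exists_eq_right]
  obtain ⟨e, w, hw, hr⟩ := e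
  exact ⟨fun h => h.2, fun h => ⟨hr.trans (linked_of_mem hw h), h⟩⟩

theorem component_isConnected (H : LabeledHypergraph V E) (r : V) :
    (H.component r).IsConnected := by
  have hroot (v : V) (h : H.Linked r v) :
      (H.component r).Linked ⟨r, Linked.refl r⟩ ⟨v, h⟩ := by
    induction h with
    | refl => exact Linked.refl _
    | tail hlinked hadj ih =>
      obtain ⟨e, hx, hy⟩ := hadj
      exact ih.trans (linked_of_mem (e := ⟨e, _, hx, hlinked⟩) (mem_component_edge.2 hx)
        (mem_component_edge.2 hy))
  rw [isConnected_iff_linked]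
  exact ⟨⟨⟨r, Linked.refl r⟩⟩, fun x y => (hroot x.1 x.2).symm.trans (hroot y.1 y.2)⟩

end Component

/-- The hypergraph without the root edge `none`. -/
def removeRootEdge (K : LabeledHypergraph V (Option E)) : LabeledHypergraph V E where
  edge e := K.edge (some e)
  two_le_card e := K.two_le_card (some e)

variable {K : LabeledHypergraph V (Option E)}

theorem IsHypertree.component_removeRootEdge (h : K.IsHypertree) (r : V) :
    (K.removeRootEdge.component r).IsHypertree :=
  ⟨component_isConnected _ _, fun m _ _ hc => h.2 m _ _ <|
    hc.map Subtype.val_injective ((Option.some_injective _).comp Subtype.val_injective)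
      fun _ _ h => mem_component_edge.1 h⟩

/-- Otherwise the root edge would close a path between the two vertices to a cycle. -/
theorem IsHypertree.eq_of_linked_removeRootEdge (h : K.IsHypertree) {x y : V}
    (hx : x ∈ K.edge none) (hy : y ∈ K.edge none) (hxy : K.removeRootEdge.Linked x y) :
    x = y := by
  obtain ⟨m, v, e, ⟨hw, hv, he⟩, rfl, rfl⟩ := hxy.exists_isPath
  by_contra hne
  have hm : m ≠ 0 := by
    rintro rfl
    exact hne rfl
  refine h.2 (m + 1) (Fin.snoc v (v 0) : Fin (m + 1 + 1) → V)
    (Fin.snoc (fun i => some (e i)) none : Fin (m + 1) → Option E) ⟨?_, by omega, ?_, ?_, ?_⟩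
  · intro i
    induction i using Fin.lastCases with
    | last =>
      rw [Fin.snoc_castSucc, Fin.succ_last, Fin.snoc_last, Fin.snoc_last]
      exact ⟨hy, hx⟩
    | cast i =>
      rw [Fin.snoc_castSucc, Fin.snoc_castSucc, Fin.succ_castSucc, Fin.snoc_castSucc]
      exact hw i
  · rw [Fin.snoc_injective_iff]
    exact ⟨(Option.some_injective _).comp he, by simp⟩
  · simpa only [Fin.snoc_castSucc] using hv
  · rw [Fin.snoc_last]
    exact Fin.snoc_castSucc (α := fun _ => V) (v 0) v 0

theorem IsConnected.exists_linked_removeRootEdge (h : K.IsConnected) (v : V) :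
    ∃ r ∈ K.edge none, K.removeRootEdge.Linked r v := by
  obtain ⟨r, hr⟩ := K.edge_nonempty none
  have hv := (isConnected_iff_linked.1 h).2 r v
  induction hv with
  | refl => exact ⟨r, hr, Linked.refl r⟩
  | tail _ hadj ih =>
    obtain ⟨_ | e, hx, hy⟩ := hadj
    · exact ⟨_, hy, Linked.refl _⟩
    · obtain ⟨s, hs, hsx⟩ := ih
      exact ⟨s, hs, hsx.trans (linked_of_mem (e := e) hx hy)⟩

end LabeledHypergraph

open LabeledHypergraph

namespace VertexRootedHypertree

variable {V E : Type}

instance [Finite V] [Finite E] : Finite (VertexRootedHypertree V E) := by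
  refine Finite.of_injective (β := Σ A : Set V, Σ B : Set E, LabeledHypergraph A B × A)
    (fun P => ⟨P.verts, P.labels, P.graph, P.root⟩) ?_
  rintro ⟨A, B, G, hG, r⟩ ⟨A', B', G', hG', r'⟩ h
  simp only [Sigma.mk.injEq] at h
  obtain ⟨rfl, h⟩ := h
  simp only [heq_eq_eq, Sigma.mk.injEq] at h
  obtain ⟨rfl, h⟩ := h
  simp only [heq_eq_eq, Prod.mk.injEq] at h
  obtain ⟨rfl, rfl⟩ := h
  rfl

theorem eq_of_edge_eq {P Q : VertexRootedHypertree V E} (hv : P.verts = Q.verts)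
    (hl : P.labels = Q.labels) (hr : (P.root : V) = Q.root)
    (he : ∀ e (h : e ∈ P.labels) (h' : e ∈ Q.labels), P.edge ⟨e, h⟩ = Q.edge ⟨e, h'⟩) :
    P = Q := by
  obtain ⟨A, B, G, hG, r⟩ := P
  obtain ⟨A', B', G', hG', r'⟩ := Q
  dsimp only at hv hl
  subst hv hl
  obtain rfl : r = r' := Subtype.ext hr
  obtain rfl : G = G' := by
    ext1
    funext e
    exact Finset.map_injective _ (he e e.2 e.2)
  rfl

/-- The vertices and edge labels that are used by `P`. -/
def support (P : VertexRootedHypertree V E) : Set (V ⊕ E) :=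
  {x | Sum.elim (· ∈ P.verts) (· ∈ P.labels) x}

variable {P : VertexRootedHypertree V E}

theorem inl_mem_support {v : V} : .inl v ∈ P.support ↔ v ∈ P.verts := Iff.rfl

theorem support_nonempty (P : VertexRootedHypertree V E) : P.support.Nonempty :=
  ⟨.inl P.root, P.root.2⟩

theorem mem_edge {e : P.labels} {v : P.verts} : v.1 ∈ P.edge e ↔ v ∈ P.graph.edge e := by
  simp [VertexRootedHypertree.edge]

theorem mem_verts_of_mem_edge {e : P.labels} {v : V} (h : v ∈ P.edge e) : v ∈ P.verts := by
  obtain ⟨w, -, rfl⟩ := Finset.mem_map.1 h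
  exact w.2

theorem card_edge (P : VertexRootedHypertree V E) (e : P.labels) :
    (P.edge e).card = (P.graph.edge e).card :=
  Finset.card_map _

theorem linked {E' : Type} {H : LabeledHypergraph V E'} (g : E → E')
    (h : ∀ e : P.labels, P.edge e = H.edge (g e)) {x y : V} (hx : x ∈ P.verts)
    (hy : y ∈ P.verts) : H.Linked x y :=
  ((isConnected_iff_linked.1 P.isHypertree.1).2 ⟨x, hx⟩ ⟨y, hy⟩).map Subtype.val (fun e => g e.1)
    fun _ e hv => h e ▸ mem_edge.2 hv

theorem card_verts [Finite V] [Fintype P.labels] :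
    Nat.card P.verts = ∑ e, ((P.edge e).card - 1) + 1 := by
  simp_rw [card_edge]
  exact (isHypertree_iff_card.1 P.isHypertree).2

end VertexRootedHypertree

namespace LabeledHypergraph

variable {V E ι : Type} {K : LabeledHypergraph V (Option E)}
  {q : ι → VertexRootedHypertree V E}

/-- The vertex-rooted hypertrees `q i` arise from `K` by removing the root edge `none` and rooting
each resulting component at its vertex in that edge. -/
structure IsRootedDecomposition (K : LabeledHypergraph V (Option E))
    (q : ι → VertexRootedHypertree V E) : Prop where
  existsUnique_mem_support : ∀ x, ∃! i, x ∈ (q i).support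
  mem_edge_none : ∀ v, v ∈ K.edge none ↔ ∃ i, ((q i).root : V) = v
  edge_eq : ∀ i (e : (q i).labels), (q i).edge e = K.edge (some e)

/-- The connected component of `r` that is left by the removal of the root edge, rooted at `r`. -/
noncomputable def IsHypertree.rootedComponent (h : K.IsHypertree) (r : V) :
    VertexRootedHypertree V E :=
  ⟨_, _, K.removeRootEdge.component r, h.component_removeRootEdge r, ⟨r, Linked.refl r⟩⟩

theorem IsHypertree.isRootedDecomposition_rootedComponent (h : K.IsHypertree) :
    K.IsRootedDecomposition fun r : K.edge none => h.rootedComponent r where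
  existsUnique_mem_support := by
    have hunique {v : V} {r s : K.edge none} (hr : K.removeRootEdge.Linked r v)
        (hs : K.removeRootEdge.Linked s v) : s = r :=
      Subtype.ext (h.eq_of_linked_removeRootEdge s.2 r.2 (hs.trans hr.symm))
    rintro (v | e)
    · obtain ⟨r, hr, hrv⟩ := h.1.exists_linked_removeRootEdge v
      exact ⟨⟨r, hr⟩, hrv, fun s hsv => hunique (r := ⟨r, hr⟩) hrv hsv⟩
    · obtain ⟨v, hv⟩ := K.edge_nonempty (some e)
      obtain ⟨r, hr, hrv⟩ := h.1.exists_linked_removeRootEdge v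
      refine ⟨⟨r, hr⟩, ⟨v, hv, hrv⟩, ?_⟩
      rintro s ⟨w, hw, hsw⟩
      exact hunique (r := ⟨r, hr⟩) hrv (Linked.trans hsw (linked_of_mem (e := e) hw hv))
  mem_edge_none v := by simp [IsHypertree.rootedComponent]
  edge_eq _ e := map_component_edge e

theorem root_injective (hq : ∀ x, ∃! i, x ∈ (q i).support) :
    Function.Injective fun i => ((q i).root : V) := fun i k (hik : ((q i).root : V) = (q k).root) =>
  (hq (.inl (q i).root)).unique (q i).root.2
    (VertexRootedHypertree.inl_mem_support.2 (hik ▸ (q k).root.2))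

theorem exists_isRootedDecomposition [Fintype ι] (hι : 2 ≤ Fintype.card ι)
    (hq : ∀ x, ∃! i, x ∈ (q i).support) :
    ∃ K : LabeledHypergraph V (Option E), K.IsRootedDecomposition q := by
  choose owner howner hunique using fun e => hq (.inr e)
  refine ⟨⟨fun e => e.elim (Finset.univ.map ⟨_, root_injective hq⟩)
    fun e => (q (owner e)).edge ⟨e, howner e⟩, ?_⟩, hq, fun v => by simp, ?_⟩
  · rintro (_ | e)
    · simpa using hι
    · exact (VertexRootedHypertree.card_edge ..).symm ▸ (q (owner e)).graph.two_le_card _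
  · rintro i ⟨e, he⟩
    obtain rfl := hunique e i he
    rfl

namespace IsRootedDecomposition

theorem mem_labels (h : K.IsRootedDecomposition q) {i : ι} {x : V} {e : E}
    (hx : x ∈ (q i).verts) (he : x ∈ K.edge (some e)) : e ∈ (q i).labels := by
  obtain ⟨k, hk, -⟩ := h.existsUnique_mem_support (.inr e)
  rw [← h.edge_eq k ⟨e, hk⟩] at he
  obtain rfl := (h.existsUnique_mem_support (.inl x)).unique hx
    (VertexRootedHypertree.mem_verts_of_mem_edge he)
  exact hk

theorem verts_eq (h : K.IsRootedDecomposition q) (i : ι) :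
    (q i).verts = {v | K.removeRootEdge.Linked (q i).root v} := by
  ext v
  refine ⟨(q i).linked id (h.edge_eq i) (q i).root.2, fun hv => ?_⟩
  induction hv with
  | refl => exact (q i).root.2
  | tail _ hadj ih =>
    obtain ⟨e, hx, hy⟩ := hadj
    have he := h.mem_labels ih hx
    exact VertexRootedHypertree.mem_verts_of_mem_edge (e := ⟨e, he⟩) (h.edge_eq i _ ▸ hy)

theorem labels_eq (h : K.IsRootedDecomposition q) (i : ι) :
    (q i).labels = {e | ∃ v ∈ K.edge (some e), v ∈ (q i).verts} := by
  ext e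
  constructor
  · intro he
    obtain ⟨v, hv⟩ := (q i).graph.edge_nonempty ⟨e, he⟩
    exact ⟨v, h.edge_eq i ⟨e, he⟩ ▸ VertexRootedHypertree.mem_edge.2 hv, v.2⟩
  · rintro ⟨v, hv, hvi⟩
    exact h.mem_labels hvi hv

theorem range_subset {ι' : Type} {q' : ι' → VertexRootedHypertree V E}
    (h : K.IsRootedDecomposition q) (h' : K.IsRootedDecomposition q') :
    Set.range q ⊆ Set.range q' := by
  rintro _ ⟨i, rfl⟩
  obtain ⟨k, hr⟩ := (h'.mem_edge_none (q i).root).1 ((h.mem_edge_none _).2 ⟨i, rfl⟩)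
  have hv : (q' k).verts = (q i).verts := by rw [h.verts_eq, h'.verts_eq, hr]
  have hl : (q' k).labels = (q i).labels := by rw [h.labels_eq, h'.labels_eq, hv]
  exact ⟨k, VertexRootedHypertree.eq_of_edge_eq hv hl hr fun e he he' => by
    rw [h.edge_eq, h'.edge_eq]⟩

theorem graph_unique {K' : LabeledHypergraph V (Option E)} (h : K.IsRootedDecomposition q)
    (h' : K'.IsRootedDecomposition q) : K = K' := by
  ext1
  funext e
  rcases e with _ | e
  · ext v
    rw [h.mem_edge_none, h'.mem_edge_none]
  · obtain ⟨i, hi, -⟩ := h.existsUnique_mem_support (.inr e)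
    rw [← h.edge_eq i ⟨e, hi⟩, ← h'.edge_eq i ⟨e, hi⟩]

theorem card_edge_none [Fintype ι] (h : K.IsRootedDecomposition q) :
    (K.edge none).card = Fintype.card ι := by
  have hedge : K.edge none = Finset.univ.map ⟨_, root_injective h.existsUnique_mem_support⟩ := by
    ext v
    simp [h.mem_edge_none]
  rw [hedge, Finset.card_map, Finset.card_univ]

theorem isConnected (h : K.IsRootedDecomposition q) : K.IsConnected := by
  obtain ⟨r, -⟩ := K.edge_nonempty none
  refine isConnected_iff_linked.2 ⟨⟨r⟩, fun x y => ?_⟩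
  obtain ⟨i, hi, -⟩ := h.existsUnique_mem_support (.inl x)
  obtain ⟨k, hk, -⟩ := h.existsUnique_mem_support (.inl y)
  have hx : K.Linked x (q i).root := (q i).linked some (h.edge_eq i) hi (q i).root.2
  have hy : K.Linked (q k).root y := (q k).linked some (h.edge_eq k) (q k).root.2 hk
  have hroots : K.Linked (q i).root (q k).root :=
    linked_of_mem ((h.mem_edge_none _).2 ⟨i, rfl⟩) ((h.mem_edge_none _).2 ⟨k, rfl⟩)
  exact hx.trans (hroots.trans hy)

theorem isHypertree [Finite V] [Finite E] [Finite ι] (h : K.IsRootedDecomposition q) :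
    K.IsHypertree := by
  classical
  have := Fintype.ofFinite E
  have := Fintype.ofFinite ι
  have hverts : Nat.card V = ∑ i, Nat.card (q i).verts := by
    rw [← Nat.card_sigma]
    exact (Nat.card_congr (Set.sigmaEquiv _ fun v => h.existsUnique_mem_support (.inl v))).symm
  have hlabels : ∑ e, ((K.edge (some e)).card - 1) =
      ∑ i, ∑ e : (q i).labels, (((q i).edge e).card - 1) := by
    rw [← Fintype.sum_sigma']
    refine (Fintype.sum_equiv
      (Set.sigmaEquiv _ fun e => h.existsUnique_mem_support (.inr e)) _ _ ?_).symm
    rintro ⟨i, e⟩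
    rw [h.edge_eq]
    rfl
  have hpos : 0 < (K.edge none).card := two_pos.trans_le (K.two_le_card none)
  refine isHypertree_iff_card.2 ⟨h.isConnected, ?_⟩
  calc Nat.card V = ∑ i, (∑ e : (q i).labels, (((q i).edge e).card - 1) + 1) := by
        simp_rw [hverts, VertexRootedHypertree.card_verts]
    _ = ∑ e, ((K.edge (some e)).card - 1) + (K.edge none).card := by
        rw [Finset.sum_add_distrib, hlabels, h.card_edge_none, ← Finset.card_eq_sum_ones,
          Finset.card_univ]
    _ = ∑ e, ((K.edge e).card - 1) + 1 := by
        rw [Fintype.sum_option]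
        omega

end IsRootedDecomposition

end LabeledHypergraph

section Removal

variable {n j : ℕ} {l : EdgeSize →₀ ℕ}

instance : Finite (EdgeRootedHypertree n l j) := Subtype.finite

instance : Finite (VertexRootedHypertreeSet n l j) := Subtype.finite

theorem VertexRootedHypertreeSet.existsUnique_mem_support (S : VertexRootedHypertreeSet n l j)
    (x : Fin n ⊕ EdgeLabel l) : ∃! P, P ∈ S.1 ∧ x ∈ P.support :=
  match x with
  | .inl v => S.2.2.1 v
  | .inr e => S.2.2.2.1 e

theorem VertexRootedHypertreeSet.existsUnique_subtype_mem_support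
    (S : VertexRootedHypertreeSet n l j) (x : Fin n ⊕ EdgeLabel l) :
    ∃! P : S.1, x ∈ P.1.support := by
  obtain ⟨P, ⟨hP, hx⟩, huniq⟩ := S.existsUnique_mem_support x
  exact ⟨⟨P, hP⟩, hx, fun Q hQ => Subtype.ext (huniq Q ⟨Q.2, hQ⟩)⟩

theorem isRemovalOfRootEdge_iff {H : EdgeRootedHypertree n l j}
    {S : VertexRootedHypertreeSet n l j} :
    IsRemovalOfRootEdge H S ↔ H.1.IsRootedDecomposition (Subtype.val : S.1 → _) :=
  ⟨fun h => ⟨S.existsUnique_subtype_mem_support, fun v => (h.1 v).trans (by simp),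
      fun P => h.2 P.1 P.2⟩,
    fun h => ⟨fun v => (h.mem_edge_none v).trans (by simp), fun P hP => h.edge_eq ⟨P, hP⟩⟩⟩

theorem exists_isRemovalOfRootEdge_right (H : EdgeRootedHypertree n l j) :
    ∃ S : VertexRootedHypertreeSet n l j, IsRemovalOfRootEdge H S := by
  obtain ⟨K, hK, hj, hsize⟩ := H
  have h := hK.isRootedDecomposition_rootedComponent
  let q : K.edge none ↪ VertexRootedHypertree (Fin n) (EdgeLabel l) :=
    ⟨_, injective_of_existsUnique_mem (fun _ => VertexRootedHypertree.support_nonempty _)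
      h.existsUnique_mem_support⟩
  refine ⟨⟨Finset.univ.map q, by simpa using hj,
    fun v => (existsUnique_mem_map_univ_iff q _).2 (h.existsUnique_mem_support (.inl v)),
    fun e => (existsUnique_mem_map_univ_iff q _).2 (h.existsUnique_mem_support (.inr e)),
    ?_⟩, fun v => (h.mem_edge_none v).trans (by simp [q]), ?_⟩
  all_goals
    simp only [Finset.mem_map, Finset.mem_univ, true_and, forall_exists_index,
      forall_apply_eq_imp_iff]
    intro i e
  · rw [← hsize, ← h.edge_eq i e]
    rfl
  · exact h.edge_eq i e

theorem exists_isRemovalOfRootEdge_left (hj : 2 ≤ j) (S : VertexRootedHypertreeSet n l j) :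
    ∃ H : EdgeRootedHypertree n l j, IsRemovalOfRootEdge H S := by
  have hS := S.existsUnique_subtype_mem_support
  obtain ⟨K, hK⟩ := exists_isRootedDecomposition (by simpa [S.2.1] using hj) hS
  refine ⟨⟨K, hK.isHypertree, by simp [hK.card_edge_none, S.2.1], fun e => ?_⟩,
    isRemovalOfRootEdge_iff.2 hK⟩
  obtain ⟨P, hP, -⟩ := hS (.inr e)
  rw [← hK.edge_eq P ⟨e, hP⟩]
  exact S.2.2.2.2 P.1 P.2 ⟨e, hP⟩

theorem IsRemovalOfRootEdge.right_unique {H : EdgeRootedHypertree n l j}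
    {S S' : VertexRootedHypertreeSet n l j} (h : IsRemovalOfRootEdge H S)
    (h' : IsRemovalOfRootEdge H S') : S = S' := by
  rw [isRemovalOfRootEdge_iff] at h h'
  have heq := (h.range_subset h').antisymm (h'.range_subset h)
  rw [Subtype.range_val, Subtype.range_val] at heq
  exact Subtype.ext (Finset.coe_injective heq)

theorem IsRemovalOfRootEdge.left_unique {H H' : EdgeRootedHypertree n l j}
    {S : VertexRootedHypertreeSet n l j} (h : IsRemovalOfRootEdge H S)
    (h' : IsRemovalOfRootEdge H' S) : H = H' := by
  rw [isRemovalOfRootEdge_iff] at h h'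
  exact Subtype.ext (h.graph_unique h')

theorem exists_equiv_isRemovalOfRootEdge (hj : 2 ≤ j) (n : ℕ) (l : EdgeSize →₀ ℕ) :
    ∃ Φ : EdgeRootedHypertree n l j ≃ VertexRootedHypertreeSet n l j,
      ∀ H, IsRemovalOfRootEdge H (Φ H) := by
  choose Φ hΦ using exists_isRemovalOfRootEdge_right (n := n) (l := l) (j := j)
  choose Ψ hΨ using exists_isRemovalOfRootEdge_left (n := n) (l := l) hj
  exact ⟨⟨Φ, Ψ, fun H => (hΨ _).left_unique (hΦ H), fun S => (hΦ _).right_unique (hΨ S)⟩, hΦ⟩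

end Removal

/-! ### Hypertrees with prescribed edge sizes -/

section Relabeling

variable {V E V' E' : Type}

/-- Hypertrees on the vertex set `V` in which the edge with label `e` has size `c e`. -/
abbrev SizedHypertree (V E : Type) (c : E → EdgeSize) : Type :=
  {H : LabeledHypergraph V E // H.IsHypertree ∧ ∀ e, (H.edge e).card = (c e).1}

namespace LabeledHypergraph

/-- The hypergraph with renamed vertices and edge labels. -/
def relabel (f : V ≃ V') (g : E ≃ E') (H : LabeledHypergraph V E) : LabeledHypergraph V' E' where
  edge e := (H.edge (g.symm e)).map f.toEmbedding
  two_le_card e := by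
    rw [Finset.card_map]
    exact H.two_le_card _

theorem relabel_symm_relabel (f : V ≃ V') (g : E ≃ E') (H : LabeledHypergraph V E) :
    (H.relabel f g).relabel f.symm g.symm = H := by
  ext e v
  simp [relabel]

theorem IsHypertree.relabel {H : LabeledHypergraph V E} (h : H.IsHypertree) (f : V ≃ V')
    (g : E ≃ E') : (H.relabel f g).IsHypertree := by
  obtain ⟨hconn, hacyclic⟩ := h
  obtain ⟨⟨r⟩, hlinked⟩ := isConnected_iff_linked.1 hconn
  refine ⟨isConnected_iff_linked.2 ⟨⟨f r⟩, fun x y => ?_⟩, fun m v e hc =>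
    hacyclic m _ _ (hc.map f.symm.injective g.symm.injective fun v e hv => ?_)⟩
  · have hxy := (hlinked (f.symm x) (f.symm y)).map (H := H.relabel f g) f g fun v e hv => by
      simpa [LabeledHypergraph.relabel] using hv
    simpa using hxy
  · simpa [LabeledHypergraph.relabel] using hv

end LabeledHypergraph

theorem card_sizedHypertree_congr {c : E → EdgeSize} {c' : E' → EdgeSize} (f : V ≃ V')
    (g : E ≃ E') (hc : ∀ e, c' (g e) = c e) :
    Nat.card (SizedHypertree V E c) = Nat.card (SizedHypertree V' E' c') :=
  Nat.card_congr
    { toFun := fun H => ⟨H.1.relabel f g, H.2.1.relabel f g, fun e => by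
        rw [relabel, Finset.card_map, H.2.2, ← hc, g.apply_symm_apply]⟩
      invFun := fun H => ⟨H.1.relabel f.symm g.symm, H.2.1.relabel f.symm g.symm, fun e => by
        rw [relabel, Finset.card_map, H.2.2, g.symm_symm, hc]⟩
      left_inv := fun H => Subtype.ext (relabel_symm_relabel f g H.1)
      right_inv := fun H => Subtype.ext (relabel_symm_relabel f.symm g.symm H.1) }

theorem colorCount_edgeLabel (l : EdgeSize →₀ ℕ) :
    colorCount (Sigma.fst : EdgeLabel l → EdgeSize) Set.univ = l := by
  ext s
  rw [colorCount_apply, Set.univ_inter, ← Nat.card_coe_set_eq]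
  exact (Nat.card_congr (Equiv.sigmaSubtype s)).trans (Nat.card_fin _)

theorem exists_equiv_edgeLabel [Finite E] (c : E → EdgeSize) :
    ∃ g : E ≃ EdgeLabel (colorCount c Set.univ), ∀ e, (g e).1 = c e := by
  have hfiber (s : EdgeSize) : Nonempty ({e // c e = s} ≃ Fin (colorCount c Set.univ s)) := by
    refine ⟨Finite.equivFinOfCardEq ?_⟩
    rw [colorCount_apply, Set.univ_inter, ← Nat.card_coe_set_eq]
    rfl
  exact ⟨(Equiv.sigmaFiberEquiv c).symm.trans (Equiv.sigmaCongrRight fun s => (hfiber s).some),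
    fun _ => rfl⟩

theorem card_sizedHypertree [Finite V] [Finite E] (c : E → EdgeSize) :
    Nat.card (SizedHypertree V E c) =
      (Hypertrees (Nat.card V) (colorCount c Set.univ)).ncard := by
  obtain ⟨g, hg⟩ := exists_equiv_edgeLabel c
  exact card_sizedHypertree_congr (c' := Sigma.fst) (Finite.equivFin V) g hg

end Relabeling

theorem magnitude_colorCount {E : Type} [Fintype E] (c : E → EdgeSize) :
    magnitude (colorCount c Set.univ) = ∑ e, ((c e).1 - 1) := by
  rw [magnitude, colorCount, finsum_mem_univ, finsum_eq_sum_of_fintype,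
    ← Finsupp.sum_finsetSum_index (by simp) (by simp [mul_add])]
  simp

theorem magnitude_eq_sum (l : EdgeSize →₀ ℕ) [Fintype (EdgeLabel l)] :
    magnitude l = ∑ e : EdgeLabel l, (e.size - 1) := by
  conv_lhs => rw [← colorCount_edgeLabel l, magnitude_colorCount]
  rfl

theorem le_magnitude_of_mem_connectedHypergraphs {n : ℕ} {l : EdgeSize →₀ ℕ}
    {H : LabeledHypergraph (Fin n) (EdgeLabel l)} (h : H ∈ ConnectedHypergraphs n l) :
    n ≤ magnitude l + 1 := by
  have := Fintype.ofFinite (EdgeLabel l)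
  have hcard := h.1.card_le
  simp_rw [h.2, Nat.card_fin] at hcard
  rwa [magnitude_eq_sum]

theorem mem_hypertrees_iff {n : ℕ} {l : EdgeSize →₀ ℕ}
    {H : LabeledHypergraph (Fin n) (EdgeLabel l)} :
    H ∈ Hypertrees n l ↔ H ∈ ConnectedHypergraphs n l ∧ n = magnitude l + 1 := by
  have := Fintype.ofFinite (EdgeLabel l)
  rw [Hypertrees, ConnectedHypergraphs, Set.mem_ofPred_eq, Set.mem_ofPred_eq, isHypertree_iff_card,
    magnitude_eq_sum, and_right_comm, Nat.card_fin]
  exact and_congr_right fun h => by simp_rw [h.2]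

/-! ### The series `C` and `T` -/

theorem egfCoeff_eq_expCoeff (F : Series) (n : ℕ) (l : EdgeSize →₀ ℕ) :
    egfCoeff F n l = expCoeff (Finsupp.optionElim n l) F := by
  have hprod : (Finsupp.optionElim n l).prod (fun _ k => k !) = n ! * multiFactorial l := by
    classical
    have herase : (Finsupp.optionElim n l).erase none = l.embDomain Function.Embedding.some := by
      ext (_ | s)
      · simp
      · rw [Finsupp.erase_ne (by simp), Finsupp.optionElim_apply_some]
        exact (Finsupp.embDomain_apply_self Function.Embedding.some l s).symm
    rw [← Finsupp.mul_prod_erase' _ none _ (by simp), Finsupp.optionElim_apply_none, herase,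
      Finsupp.prod_embDomain, multiFactorial]
  rw [egfCoeff, expCoeff, hprod]
  push_cast
  ring

theorem egfCoeff_ext {F G : Series} (h : ∀ n l, egfCoeff F n l = egfCoeff G n l) : F = G := by
  ext m
  have hm := h (m none) m.some
  rw [egfCoeff_eq_expCoeff, egfCoeff_eq_expCoeff, Finsupp.optionElim_some] at hm
  exact mul_left_cancel₀ (Nat.cast_ne_zero.2 (prod_factorial_ne_zero m)) hm

theorem egfCoeff_C (n : ℕ) (l : EdgeSize →₀ ℕ) :
    egfCoeff C n l = (ConnectedHypergraphs n l).ncard := by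
  have hcoeff : MvPowerSeries.coeff (Finsupp.optionElim n l) C = C (Finsupp.optionElim n l) := rfl
  have hn : (n ! : ℚ) ≠ 0 := Nat.cast_ne_zero.2 n.factorial_ne_zero
  have hl : (multiFactorial l : ℚ) ≠ 0 := Nat.cast_ne_zero.2 (prod_factorial_ne_zero l)
  rw [egfCoeff, hcoeff, C, Finsupp.some_optionElim, Finsupp.optionElim_apply_none]
  field_simp

theorem le_magnitude_of_egfCoeff_C_ne_zero (n : ℕ) (l : EdgeSize →₀ ℕ) (h : egfCoeff C n l ≠ 0) :
    n ≤ magnitude l + 1 := by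
  rw [egfCoeff_C, Nat.cast_ne_zero] at h
  obtain ⟨H, hH⟩ := Set.nonempty_of_ncard_ne_zero h
  exact le_magnitude_of_mem_connectedHypergraphs hH

theorem egfCoeff_T (n : ℕ) (l : EdgeSize →₀ ℕ) :
    egfCoeff T n l = if magnitude l + 1 = n then egfCoeff C n l else 0 := by
  have hcoeff : MvPowerSeries.coeff (Finsupp.optionElim n l) T = T (Finsupp.optionElim n l) := rfl
  rw [egfCoeff, hcoeff, T, Finsupp.some_optionElim, Finsupp.optionElim_apply_none, mul_ite,
    mul_zero, egfCoeff]

theorem egfCoeff_T_eq_ncard_hypertrees (n : ℕ) (l : EdgeSize →₀ ℕ) :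
    egfCoeff T n l = (Hypertrees n l).ncard := by
  have hHypertrees : Hypertrees n l = {H | H ∈ ConnectedHypergraphs n l ∧ n = magnitude l + 1} :=
    Set.ext fun _ => mem_hypertrees_iff
  rw [egfCoeff_T, egfCoeff_C, hHypertrees, eq_comm (a := n)]
  split_ifs with h <;> simp [h]

theorem egfCoeff_tDeriv (F : Series) (n : ℕ) (l : EdgeSize →₀ ℕ) :
    egfCoeff (tDeriv F) n l = n * egfCoeff F n l := by
  rw [egfCoeff_eq_expCoeff, egfCoeff_eq_expCoeff, tDeriv, expCoeff_X_mul_pderiv,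
    Finsupp.optionElim_apply_none]

theorem egfCoeff_pderiv_uVar (F : Series) (j : ℕ) (hj : 2 ≤ j) (n : ℕ) (l : EdgeSize →₀ ℕ) :
    egfCoeff (MvPowerSeries.pderiv ℚ (uVar j hj) F) n l =
      egfCoeff F n (l + Finsupp.single ⟨j, hj⟩ 1) := by
  rw [egfCoeff_eq_expCoeff, egfCoeff_eq_expCoeff, ← expCoeff_add_single]
  congr 1
  ext (_ | s) <;> simp [Finsupp.single_apply]

/-! ### What the two sides of the differential equation count -/

theorem egfCoeff_pderiv_T (j : ℕ) (hj : 2 ≤ j) (n : ℕ) (l : EdgeSize →₀ ℕ) :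
    egfCoeff (MvPowerSeries.pderiv ℚ (uVar j hj) T) n l =
      Nat.card (EdgeRootedHypertree n l j) := by
  let c (e : Option (EdgeLabel l)) : EdgeSize := e.elim ⟨j, hj⟩ Sigma.fst
  have hc : colorCount c Set.univ = l + Finsupp.single ⟨j, hj⟩ 1 := by
    rw [colorCount_of_none_mem c (Set.mem_univ _)]
    exact congrArg (· + _) (colorCount_edgeLabel l)
  have hcard := card_sizedHypertree (V := Fin n) c
  rw [Nat.card_fin, hc] at hcard
  rw [egfCoeff_pderiv_uVar, egfCoeff_T_eq_ncard_hypertrees, ← hcard]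
  exact congrArg _ (Nat.card_congr (Equiv.subtypeEquivRight fun H =>
    and_congr_right fun _ => Option.forall))

section VertexRooted

variable {V E : Type}

/-- The variable that counts a vertex or an edge label: `t` for a vertex and `u_i` for the label of
an `i`-edge. -/
def labelColor (c : E → EdgeSize) : V ⊕ E → Option EdgeSize :=
  Sum.elim (fun _ => tVar) fun e => some (c e)

theorem colorCount_labelColor [Finite V] [Finite E] (c : E → EdgeSize) (s : Set (V ⊕ E)) :
    colorCount (labelColor c) s =
      Finsupp.optionElim (Sum.inl ⁻¹' s).ncard (colorCount c (Sum.inr ⁻¹' s)) := by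
  ext (_ | i)
  · rw [colorCount_apply, Finsupp.optionElim_apply_none,
      ← Set.ncard_image_of_injective (Sum.inl ⁻¹' s) Sum.inl_injective]
    congr 1
    ext (v | e) <;> simp [labelColor]
  · rw [colorCount_apply, Finsupp.optionElim_apply_some, colorCount_apply,
      ← Set.ncard_image_of_injective (Sum.inr ⁻¹' s ∩ _) Sum.inr_injective]
    congr 1
    ext (v | e) <;> simp [labelColor]

/-- The vertex-rooted hypertrees in which the edge with label `e` has size `c e`. -/
def sizedVertexRootedHypertrees (V : Type) (c : E → EdgeSize) : Set (VertexRootedHypertree V E) :=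
  {P | ∀ e : P.labels, (P.edge e).card = (c e).1}

theorem card_sizedVertexRootedHypertrees_support_eq (c : E → EdgeSize) (s : Set (V ⊕ E)) :
    Nat.card {P // P ∈ sizedVertexRootedHypertrees V c ∧ P.support = s} =
      (Sum.inl ⁻¹' s).ncard *
        Nat.card (SizedHypertree (Sum.inl ⁻¹' s) (Sum.inr ⁻¹' s) fun e => c e) := by
  rw [← Nat.card_coe_set_eq, ← Nat.card_prod]
  symm
  refine Nat.card_eq_of_bijective
    (fun p : (Sum.inl ⁻¹' s : Set V) × SizedHypertree (Sum.inl ⁻¹' s) (Sum.inr ⁻¹' s) _ =>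
      ⟨⟨_, _, p.2.1, p.2.2.1, p.1⟩, fun e => ?_, ?_⟩) ⟨?_, ?_⟩
  · exact (VertexRootedHypertree.card_edge _ e).trans (p.2.2.2 e)
  · ext (v | e) <;> rfl
  · rintro ⟨r, G, hG⟩ ⟨r', G', hG'⟩ h
    simp only [Subtype.mk.injEq, VertexRootedHypertree.mk.injEq, heq_eq_eq, true_and] at h
    obtain ⟨rfl, rfl⟩ := h
    rfl
  · rintro ⟨P, hP, rfl⟩
    exact ⟨⟨P.root, P.graph, P.isHypertree, fun e => (P.card_edge e).symm.trans (hP e)⟩, rfl⟩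

theorem expCoeff_tDeriv_T [Finite V] [Finite E] (c : E → EdgeSize) (s : Set (V ⊕ E)) :
    expCoeff (colorCount (labelColor c) s) (tDeriv T) =
      Nat.card {P // P ∈ sizedVertexRootedHypertrees V c ∧ P.support = s} := by
  rw [card_sizedVertexRootedHypertrees_support_eq, card_sizedHypertree, colorCount_comp_val,
    colorCount_labelColor, ← egfCoeff_eq_expCoeff, egfCoeff_tDeriv,
    egfCoeff_T_eq_ncard_hypertrees, Nat.card_coe_set_eq, Nat.cast_mul]

end VertexRooted

theorem egfCoeff_smul_tDeriv_T_pow (n : ℕ) (l : EdgeSize →₀ ℕ) (j : ℕ) :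
    egfCoeff ((1 / (j ! : ℚ)) • tDeriv T ^ j) n l = Nat.card (VertexRootedHypertreeSet n l j) := by
  let c : EdgeLabel l → EdgeSize := Sigma.fst
  have hc : Finsupp.optionElim n l = colorCount (labelColor (V := Fin n) c) Set.univ := by
    rw [colorCount_labelColor, Set.preimage_univ, Set.preimage_univ, colorCount_edgeLabel,
      Set.ncard_univ, Nat.card_fin]
  rw [egfCoeff_eq_expCoeff, hc, expCoeff_smul_pow_eq_card_finset VertexRootedHypertree.support
    (sizedVertexRootedHypertrees (Fin n) c) (fun P _ => P.support_nonempty) _ _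
    (expCoeff_tDeriv_T c)]
  refine congrArg _ (Nat.card_congr (Equiv.subtypeEquivRight fun S => and_congr_right fun _ => ?_))
  rw [Sum.forall, and_comm, and_assoc]
  rfl

theorem pderiv_uVar_T (j : ℕ) (hj : 2 ≤ j) :
    MvPowerSeries.pderiv ℚ (uVar j hj) T = (1 / (j ! : ℚ)) • tDeriv T ^ j := by
  refine egfCoeff_ext fun n l => ?_
  obtain ⟨Φ, -⟩ := exists_equiv_isRemovalOfRootEdge hj n l
  rw [egfCoeff_pderiv_T, egfCoeff_smul_tDeriv_T_pow, Nat.card_congr Φ]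

theorem pderiv_uVar_T_succ (j : ℕ) (hj : 2 ≤ j) :
    MvPowerSeries.pderiv ℚ (uVar (j + 1) (hj.trans j.le_succ)) T =
      (1 / ((j + 1 : ℕ) : ℚ)) • (tDeriv T * MvPowerSeries.pderiv ℚ (uVar j hj) T) := by
  rw [pderiv_uVar_T, pderiv_uVar_T, mul_smul_comm, smul_smul, pow_succ', Nat.factorial_succ,
    Nat.cast_mul, one_div_mul_one_div]

end HypertreeEGF

theorem mainTheorem4 :
    -- every term of `C_n` has magnitude at least `n - 1`, so `T` collects the leading terms of `C`
    (∀ (n : ℕ) (l : EdgeSize →₀ ℕ), egfCoeff C n l ≠ 0 → n ≤ magnitude l + 1) ∧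
    -- `T` is the exponential generating function of labeled hypertrees
    (∀ (n : ℕ) (l : EdgeSize →₀ ℕ), egfCoeff T n l = (Hypertrees n l).ncard) ∧
    -- the two recursions
    (MvPowerSeries.pderiv ℚ (uVar 2 le_rfl) T = (1 / 2 : ℚ) • tDeriv T ^ 2) ∧
    (∀ (j : ℕ) (hj : 3 ≤ j),
      MvPowerSeries.pderiv ℚ (uVar j (by omega)) T =
        (1 / (j : ℚ)) • (tDeriv T * MvPowerSeries.pderiv ℚ (uVar (j - 1) (by omega)) T)) ∧
    -- the differential equation
    (∀ (j : ℕ) (hj : 2 ≤ j),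
      MvPowerSeries.pderiv ℚ (uVar j hj) T = (1 / (j ! : ℚ)) • tDeriv T ^ j) ∧
    -- what its two sides count, and the bijection between the objects counted
    (∀ (j : ℕ) (hj : 2 ≤ j) (n : ℕ) (l : EdgeSize →₀ ℕ),
      Finite (EdgeRootedHypertree n l j) ∧
      Finite (VertexRootedHypertreeSet n l j) ∧
      egfCoeff (MvPowerSeries.pderiv ℚ (uVar j hj) T) n l = Nat.card (EdgeRootedHypertree n l j) ∧
      egfCoeff ((1 / (j ! : ℚ)) • tDeriv T ^ j) n l = Nat.card (VertexRootedHypertreeSet n l j) ∧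
      ∃ Φ : EdgeRootedHypertree n l j ≃ VertexRootedHypertreeSet n l j,
        ∀ H, IsRemovalOfRootEdge H (Φ H)) := by
  refine ⟨le_magnitude_of_egfCoeff_C_ne_zero, egfCoeff_T_eq_ncard_hypertrees, ?_, fun j hj => ?_,
    pderiv_uVar_T, fun j hj n l => ⟨inferInstance, inferInstance, egfCoeff_pderiv_T j hj n l,
      egfCoeff_smul_tDeriv_T_pow n l j, exists_equiv_isRemovalOfRootEdge hj n l⟩⟩
  · simpa using pderiv_uVar_T 2 le_rfl
  · obtain ⟨k, rfl⟩ : ∃ k, j = k + 1 := ⟨j - 1, by omega⟩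
    exact pderiv_uVar_T_succ k (by omega)
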